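/- Let $q$ be a positive integer. A $\mathrm{UG}(q)$ instance is a finite structure $\mathbb A$ with nonempty universe $A$ over the vocabulary that has one binary relation symbol $P_\pi$ for every permutation $\pi$ of $[q]=\{1,\dots,q\}$. The elements of $A$ are the variables, and each pair $(x,y)\in P_\pi^{\mathbb A}$ is a constraint, which an assignment $f:A\to[q]$ satisfies if $\pi(f(x))=f(y)$. The instance is completely satisfiable if some assignment satisfies all of its constraints. Its optimal value $\mathrm{opt}(\mathbb A)$ is the maximum over all assignments of the fraction of constraints satisfied (this fraction being $1$ if there are no constraints). FPC is first-order logic, over a structure together with the ordered number sort $\{0,\dots,|A|\}$, extended by least fixed points of formulas positive in the relation variable that they define and by counting quantifiers $\exists^{\ge\nu}x$ with $\nu$ a number variable; LFP is its fragment that does not use numbers. $C^k$ is first-order logic with counting quantifiers $\exists^{\ge m}x$ ($m\in\mathbb N$) and arbitrary, possibly infinite, conjunctions and disjunctions, in which only $k$ variables are used. **Proposition.** For every positive integer $q$: 1. There is an LFP sentence $\phi$ (in particular, an FPC sentence) such that for every $\mathrm{UG}(q)$ instance $\mathbb A$, $\mathbb A\models\phi$ if and only if $\mathbb A$ is completely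 satisfiable. Furthermore, there is a sentence $\psi$ of $C^3$ such that $\mathbb A\models\psi\iff\mathbb A\models\phi$ for every $\mathrm{UG}(q)$ instance $\mathbb A$. 2. Consequently, for no real $\delta\le 1$ does $\mathrm{UG}(q)$ have a $(1,\delta)$ FPC-inapproximability gap: there is an FPC sentence that is true in every $\mathrm{UG}(q)$ instance with $\mathrm{opt}(\mathbb A)\ge 1$ and false in every $\mathrm{UG}(q)$ instance with $\mathrm{opt}(\mathbb A)<\delta$. -/

import Mathlib

universe u

/-! ### Fixed-point logic with counting over finite relational structures -/

namespace FPC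

/-- A relation variable of mixed type: it takes `elemArity` arguments that are elements of the
structure and `numArity` arguments that are numbers. -/
structure RelVar where
  name : ℕ
  elemArity : ℕ
  numArity : ℕ
deriving DecidableEq

/-- Formulas of fixed-point logic with counting over the relational vocabulary `L`. Element
variables, number variables and relation variables are named by natural numbers (relation
variables also carry their type). All other connectives and quantifiers, equality of numbers,
zero, successor and counting terms are definable from those below. -/
inductive Formula (L : FirstOrder.Language.{0, 0}) : Type where
  /-- `x = y` -/
  | eq (x y : ℕ) : Formula L
  /-- `R(x₁, …, xₙ)` for a symbol `R` of the vocabulary -/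
  | rel {n : ℕ} (R : L.Relations n) (xs : Fin n → ℕ) : Formula L
  /-- `μ ≤ ν` for number variables -/
  | numLe (μ ν : ℕ) : Formula L
  /-- `X(x₁, …, x_a, ν₁, …, ν_b)` for a relation variable `X` -/
  | app (X : RelVar) (xs : Fin X.elemArity → ℕ) (νs : Fin X.numArity → ℕ) : Formula L
  | neg (φ : Formula L) : Formula L
  | and (φ ψ : Formula L) : Formula L
  /-- `∃ x φ`, with `x` an element variable -/
  | exElem (x : ℕ) (φ : Formula L) : Formula L
  /-- `∃ ν φ`, with `ν` a number variable -/
  | exNum (ν : ℕ) (φ : Formula L) : Formula L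
  /-- `∃^{≥ ν} x φ`, with `ν` a number variable: at least `ν` elements `x` satisfy `φ` -/
  | countGe (ν : ℕ) (x : ℕ) (φ : Formula L) : Formula L
  /-- `[lfp_{X, xs, νs} φ](us, μs)` -/
  | lfp (X : RelVar) (xs : Fin X.elemArity → ℕ) (νs : Fin X.numArity → ℕ) (φ : Formula L)
      (us : Fin X.elemArity → ℕ) (μs : Fin X.numArity → ℕ) : Formula L

namespace Formula

variable {L : FirstOrder.Language.{0, 0}}

/-- `φ.OccursOnly true X`: every free occurrence of `X` in `φ` is positive (under an even number
of negations). `φ.OccursOnly false X`: every free occurrence of `X` in `φ` is negative. -/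
def OccursOnly : Formula L → Bool → RelVar → Prop
  | eq _ _, _, _ => True
  | rel _ _, _, _ => True
  | numLe _ _, _, _ => True
  | app Y _ _, pol, X => Y = X → pol = true
  | neg φ, pol, X => φ.OccursOnly (!pol) X
  | and φ ψ, pol, X => φ.OccursOnly pol X ∧ ψ.OccursOnly pol X
  | exElem _ φ, pol, X => φ.OccursOnly pol X
  | exNum _ φ, pol, X => φ.OccursOnly pol X
  | countGe _ _ φ, pol, X => φ.OccursOnly pol X
  | lfp Y _ _ φ _ _, pol, X => Y = X ∨ φ.OccursOnly pol X

/-- In every subformula `[lfp_{X, xs, νs} φ](us, μs)` the bound variables are distinct and `X`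
occurs only positively in `φ`. -/
def WellFormed : Formula L → Prop
  | eq _ _ => True
  | rel _ _ => True
  | numLe _ _ => True
  | app _ _ _ => True
  | neg φ => φ.WellFormed
  | and φ ψ => φ.WellFormed ∧ ψ.WellFormed
  | exElem _ φ => φ.WellFormed
  | exNum _ φ => φ.WellFormed
  | countGe _ _ φ => φ.WellFormed
  | lfp X xs νs φ _ _ =>
      Function.Injective xs ∧ Function.Injective νs ∧ φ.OccursOnly true X ∧ φ.WellFormed

/-- The free element variables. -/
def freeElem : Formula L → Set ℕ
  | eq x y => {x, y}
  | rel _ xs => Set.range xs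
  | numLe _ _ => ∅
  | app _ xs _ => Set.range xs
  | neg φ => φ.freeElem
  | and φ ψ => φ.freeElem ∪ ψ.freeElem
  | exElem x φ => φ.freeElem \ {x}
  | exNum _ φ => φ.freeElem
  | countGe _ x φ => φ.freeElem \ {x}
  | lfp _ xs _ φ us _ => (φ.freeElem \ Set.range xs) ∪ Set.range us

/-- The free number variables. -/
def freeNum : Formula L → Set ℕ
  | eq _ _ => ∅
  | rel _ _ => ∅
  | numLe μ ν => {μ, ν}
  | app _ _ νs => Set.range νs
  | neg φ => φ.freeNum
  | and φ ψ => φ.freeNum ∪ ψ.freeNum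
  | exElem _ φ => φ.freeNum
  | exNum ν φ => φ.freeNum \ {ν}
  | countGe ν _ φ => insert ν φ.freeNum
  | lfp _ _ νs φ _ μs => (φ.freeNum \ Set.range νs) ∪ Set.range μs

/-- The free relation variables. -/
def freeRel : Formula L → Set RelVar
  | eq _ _ => ∅
  | rel _ _ => ∅
  | numLe _ _ => ∅
  | app X _ _ => {X}
  | neg φ => φ.freeRel
  | and φ ψ => φ.freeRel ∪ ψ.freeRel
  | exElem _ φ => φ.freeRel
  | exNum _ φ => φ.freeRel
  | countGe _ _ φ => φ.freeRel
  | lfp X _ _ φ _ _ => φ.freeRel \ {X}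

/-- The formulas of least fixed-point logic LFP: those formulas of FPC in which numbers are not
used at all (no number variable, no counting quantifier, no relation variable with a number
argument). -/
def IsLFP : Formula L → Prop
  | eq _ _ => True
  | rel _ _ => True
  | numLe _ _ => False
  | app X _ _ => X.numArity = 0
  | neg φ => φ.IsLFP
  | and φ ψ => φ.IsLFP ∧ ψ.IsLFP
  | exElem _ φ => φ.IsLFP
  | exNum _ _ => False
  | countGe _ _ _ => False
  | lfp X _ _ φ _ _ => X.numArity = 0 ∧ φ.IsLFP

end Formula

/-- The number sort attached to a finite structure with `n` elements: the numbers `0, …, n`. -/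
abbrev Num (M : Type u) : Type := Fin (Nat.card M + 1)

/-- The relations on `M` and its number sort that a relation variable can denote. -/
abbrev RelVal (M : Type u) (X : RelVar) : Type u :=
  Set ((Fin X.elemArity → M) × (Fin X.numArity → Num M))

/-- Satisfaction of a formula in a finite structure `M`, under an assignment `e` of the element
variables, `n` of the number variables and `r` of the relation variables. The least fixed point of
the operator defined by `φ` is the intersection of all relations that the operator maps into
themselves. -/
def Formula.Realize {L : FirstOrder.Language.{0, 0}} (M : Type u) [L.Structure M] :
    Formula L → (ℕ → M) → (ℕ → Num M) → (∀ X : RelVar, RelVal M X) → Prop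
  | .eq x y, e, _, _ => e x = e y
  | .rel R xs, e, _, _ => FirstOrder.Language.Structure.RelMap R (fun i => e (xs i))
  | .numLe μ ν, _, n, _ => n μ ≤ n ν
  | .app X xs νs, e, n, r => (fun i => e (xs i), fun i => n (νs i)) ∈ r X
  | .neg φ, e, n, r => ¬ φ.Realize M e n r
  | .and φ ψ, e, n, r => φ.Realize M e n r ∧ ψ.Realize M e n r
  | .exElem x φ, e, n, r => ∃ a : M, φ.Realize M (Function.update e x a) n r
  | .exNum ν φ, e, n, r => ∃ k : Num M, φ.Realize M e (Function.update n ν k) r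
  | .countGe ν x φ, e, n, r =>
      (n ν : ℕ) ≤ Set.ncard {a : M | φ.Realize M (Function.update e x a) n r}
  | .lfp X xs νs φ us μs, e, n, r =>
      ∀ S : RelVal M X,
        (∀ p : (Fin X.elemArity → M) × (Fin X.numArity → Num M),
          φ.Realize M (Function.extend xs p.1 e) (Function.extend νs p.2 n)
            (Function.update r X S) → p ∈ S) →
        ((fun i => e (us i), fun i => n (μs i)) :
          (Fin X.elemArity → M) × (Fin X.numArity → Num M)) ∈ S

/-- A sentence of FPC: a well-formed formula without free variables of any kind. -/
structure Sentence (L : FirstOrder.Language.{0, 0}) where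
  formula : Formula L
  wellFormed : formula.WellFormed
  freeElem_eq : formula.freeElem = ∅
  freeNum_eq : formula.freeNum = ∅
  freeRel_eq : formula.freeRel = ∅

/-- `M ⊨ φ`. A sentence has no free variables, so the assignment is immaterial. -/
def Sentence.Holds {L : FirstOrder.Language.{0, 0}} (φ : Sentence L) (M : Type u) [L.Structure M] : Prop :=
  ∀ (e : ℕ → M) (n : ℕ → Num M) (r : ∀ X : RelVar, RelVal M X), φ.formula.Realize M e n r

end FPC

/-! ### Infinitary counting logic with `k` variables -/

namespace Ck

/-- Formulas of `C^k` over the relational vocabulary `L`: first-order logic with the counting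
quantifiers `∃^{≥ m} x` for fixed natural numbers `m` and with arbitrary, possibly infinite,
conjunctions, in which only `k` variables are used. -/
inductive Formula (L : FirstOrder.Language.{0, 0}) (k : ℕ) : Type 1 where
  | eq (x y : Fin k) : Formula L k
  | rel {n : ℕ} (R : L.Relations n) (xs : Fin n → Fin k) : Formula L k
  | neg (φ : Formula L k) : Formula L k
  | conj {ι : Type} (φ : ι → Formula L k) : Formula L k
  /-- `∃^{≥ m} x φ` -/
  | exGe (m : ℕ) (x : Fin k) (φ : Formula L k) : Formula L k

variable {L : FirstOrder.Language.{0, 0}} {k : ℕ}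

/-- The free variables. -/
def Formula.free : Formula L k → Set (Fin k)
  | .eq x y => {x, y}
  | .rel _ xs => Set.range xs
  | .neg φ => φ.free
  | .conj φ => ⋃ i, (φ i).free
  | .exGe _ x φ => φ.free \ {x}

/-- Satisfaction of a formula in a finite structure `M` under the assignment `e`. -/
def Formula.Realize (M : Type u) [L.Structure M] : Formula L k → (Fin k → M) → Prop
  | .eq x y, e => e x = e y
  | .rel R xs, e => FirstOrder.Language.Structure.RelMap R (fun i => e (xs i))
  | .neg φ, e => ¬ φ.Realize M e
  | .conj φ, e => ∀ i, (φ i).Realize M e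
  | .exGe m x φ, e => m ≤ Set.ncard {a : M | φ.Realize M (Function.update e x a)}

/-- A sentence of `C^k`: a formula without free variables. -/
structure Sentence (L : FirstOrder.Language.{0, 0}) (k : ℕ) where
  formula : Formula L k
  free_eq : formula.free = ∅

/-- `M ⊨ φ`. A sentence has no free variables, so the assignment is immaterial. -/
def Sentence.Holds (φ : Sentence L k) (M : Type u) [L.Structure M] : Prop :=
  ∀ e : Fin k → M, φ.formula.Realize M e

end Ck

/-! ### Unique games -/

namespace UG

/-- The symbols of the vocabulary of `UG(q)`: one binary symbol `P π` for every permutation `π` of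
the label set. -/
inductive Rel (q : ℕ) : ℕ → Type where
  | P (π : Equiv.Perm (Fin q)) : Rel q 2

/-- The vocabulary of `UG(q)`; the label set is `Fin q`. A `UG(q)` instance is a finite structure
`M` over it: the elements of `M` are the variables, and `P π` holds of `(x, y)` iff there is a
constraint demanding that the labels of `x` and `y` satisfy `π (label x) = label y`. -/
def vocabulary (q : ℕ) : FirstOrder.Language.{0, 0} where
  Functions := fun _ => Empty
  Relations := Rel q

variable (q : ℕ) (M : Type u) [(vocabulary q).Structure M]

/-- The constraints of an instance: `(π, x, y)` is a constraint if `P π` holds of `(x, y)`. -/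
def constraints : Set (Equiv.Perm (Fin q) × M × M) :=
  {c | FirstOrder.Language.Structure.RelMap (L := vocabulary q) (Rel.P c.1) ![c.2.1, c.2.2]}

/-- The constraint `(π, x, y)` is satisfied by the assignment `f` if `π (f x) = f y`. -/
def Satisfies {q : ℕ} {M : Type u} (f : M → Fin q) (c : Equiv.Perm (Fin q) × M × M) : Prop :=
  c.1 (f c.2.1) = f c.2.2

/-- Some assignment of labels to the variables satisfies all the constraints. -/
def CompletelySatisfiable : Prop :=
  ∃ f : M → Fin q, ∀ c ∈ constraints q M, Satisfies f c

open Classical in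
/-- The fraction of the constraints that `f` satisfies (`1` if there are no constraints). -/
noncomputable def satFraction (f : M → Fin q) : ℝ :=
  if constraints q M = ∅ then 1
  else (Set.ncard {c ∈ constraints q M | Satisfies f c} : ℝ) / (Set.ncard (constraints q M) : ℝ)

/-- The optimal value of an instance: the maximum, over all assignments, of the fraction of
satisfied constraints. (An instance is finite and `q` is positive, so the supremum is taken over a
nonempty finite set of values, and is attained.) -/
noncomputable def opt : ℝ := ⨆ f : M → Fin q, satFraction q M f

/-- The sentence `φ` of FPC distinguishes `UG(q)` instances of optimal value at least `c` from
those of optimal value less than `s`. -/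
def FPCDistinguishes (q : ℕ) (φ : FPC.Sentence (vocabulary q)) (c s : ℝ) : Prop :=
  ∀ (M : Type u) [Finite M] [Nonempty M] [(vocabulary q).Structure M],
    (c ≤ opt q M → φ.Holds M) ∧ (opt q M < s → ¬ φ.Holds M)

/-- `UG(q)` has a `(c, s)` FPC-inapproximability gap: no sentence of FPC distinguishes instances of
optimal value at least `c` from instances of optimal value less than `s`. -/
def HasFPCInapproximabilityGap (q : ℕ) (c s : ℝ) : Prop :=
  ¬ ∃ φ : FPC.Sentence (vocabulary q), FPCDistinguishes.{u} q φ c s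

end UG

/-! Consider the graph on pairs (variable, label) in which each constraint, read in either
direction, joins `(a, i)` to the label of `b` that it forces. Constraints are permutations, so a
walk can be retraced from any other starting label, and distinct labels stay distinct along it
(`Forces.exists_parallel`). Hence an instance is completely satisfiable iff every variable `a` has a
label `i` such that `(a, i)` reaches no `(a, i')` with `i' ≠ i` (`completelySatisfiable_iff`): such
a label at one root per component spreads uniquely to the whole component.

It remains to define reachability. In LFP the labels are not elements of the structure; Kleene's
algorithm eliminates them one by one, leaving nested transitive closures of binary relations. In
`C^3` one takes an infinite disjunction over walk lengths, reusing three variables. For the gap,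
optimal value at least 1 means complete satisfiability, since the supremum is attained. -/

namespace FPC

variable {L : FirstOrder.Language.{0, 0}}

/-! ### LFP-definable binary queries and their closure properties. -/

namespace Formula

theorem occursOnly_of_notMem_freeRel (φ : Formula L) (X : RelVar) (h : X ∉ φ.freeRel)
    (pol : Bool) : φ.OccursOnly pol X := by
  induction φ generalizing pol with
  | eq => trivial
  | rel => trivial
  | numLe => trivial
  | app Y _ _ => exact fun hY => absurd (by simp [freeRel, hY]) h
  | neg φ ih => exact ih h _
  | and φ ψ ih₁ ih₂ =>
      simp only [freeRel, Set.mem_union, not_or] at h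
      exact ⟨ih₁ h.1 _, ih₂ h.2 _⟩
  | exElem _ φ ih => exact ih h _
  | exNum _ φ ih => exact ih h _
  | countGe _ _ φ ih => exact ih h _
  | lfp Y _ _ φ _ _ ih =>
      by_cases hY : Y = X
      · exact Or.inl hY
      · refine Or.inr (ih (fun hX => h ⟨hX, ?_⟩) _)
        exact fun hXY => hY hXY.symm

theorem IsLFP.freeNum_eq_empty {φ : Formula L} (h : φ.IsLFP) : φ.freeNum = ∅ := by
  induction φ with
  | eq => rfl
  | rel => rfl
  | numLe => exact h.elim
  | app X _ _ =>
      have : IsEmpty (Fin X.numArity) := by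
        rw [show X.numArity = 0 from h]; infer_instance
      exact Set.range_eq_empty _
  | neg φ ih => exact ih h
  | and φ ψ ih₁ ih₂ => simp [freeNum, ih₁ h.1, ih₂ h.2]
  | exElem _ φ ih => exact ih h
  | exNum => exact h.elim
  | countGe => exact h.elim
  | lfp X _ _ φ _ _ ih =>
      have : IsEmpty (Fin X.numArity) := by
        rw [h.1]; infer_instance
      simp [freeNum, ih h.2, Set.range_eq_empty]

end Formula

variable (L) in
/-- A binary query is LFP-definable if some LFP formula, without free relation variables and with
free element variables among `0` and `1`, defines it in every structure. -/
def LFPDefinable (R : ∀ (M : Type u) [L.Structure M], M → M → Prop) : Prop :=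
  ∃ φ : Formula L, φ.WellFormed ∧ φ.IsLFP ∧ φ.freeElem ⊆ {0, 1} ∧ φ.freeRel = ∅ ∧
    ∀ (M : Type u) [L.Structure M] (e : ℕ → M) (n : ℕ → Num M) (r : ∀ X : RelVar, RelVal M X),
      φ.Realize M e n r ↔ R M (e 0) (e 1)

namespace LFPDefinable

variable {R S : ∀ (M : Type u) [L.Structure M], M → M → Prop}

theorem congr (hR : LFPDefinable L R)
    (h : ∀ (M : Type u) [L.Structure M] (a b : M), R M a b ↔ S M a b) : LFPDefinable L S := by
  obtain ⟨φ, h₁, h₂, h₃, h₄, h₅⟩ := hR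
  exact ⟨φ, h₁, h₂, h₃, h₄, fun M _ e n r => (h₅ M e n r).trans (h M _ _)⟩

theorem true : LFPDefinable L fun (M : Type u) _ (_ _ : M) => True :=
  ⟨.eq 0 0, trivial, trivial, by simp [Formula.freeElem], rfl, fun M _ e n r => by
    simp [Formula.Realize]⟩

theorem rel (P : L.Relations 2) :
    LFPDefinable L fun (M : Type u) _ (a b : M) =>
      FirstOrder.Language.Structure.RelMap P ![a, b] := by
  refine ⟨.rel P ![0, 1], trivial, trivial, by simp [Formula.freeElem, Set.pair_comm], rfl,
    fun M _ e n r => ?_⟩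
  have : (fun i => e (![0, 1] i)) = ![e 0, e 1] := by
    ext i; fin_cases i <;> rfl
  simp [Formula.Realize, this]

theorem relSwap (P : L.Relations 2) :
    LFPDefinable L fun (M : Type u) _ (a b : M) =>
      FirstOrder.Language.Structure.RelMap P ![b, a] := by
  refine ⟨.rel P ![1, 0], trivial, trivial, by simp [Formula.freeElem], rfl,
    fun M _ e n r => ?_⟩
  have : (fun i => e (![1, 0] i)) = ![e 1, e 0] := by
    ext i; fin_cases i <;> rfl
  simp [Formula.Realize, this]

theorem not (hR : LFPDefinable L R) : LFPDefinable L fun M _ a b => ¬ R M a b := by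
  obtain ⟨φ, h₁, h₂, h₃, h₄, h₅⟩ := hR
  exact ⟨.neg φ, h₁, h₂, h₃, h₄, fun M _ e n r => not_congr (h₅ M e n r)⟩

theorem and (hR : LFPDefinable L R) (hS : LFPDefinable L S) :
    LFPDefinable L fun M _ a b => R M a b ∧ S M a b := by
  obtain ⟨φ, h₁, h₂, h₃, h₄, h₅⟩ := hR
  obtain ⟨ψ, k₁, k₂, k₃, k₄, k₅⟩ := hS
  exact ⟨.and φ ψ, ⟨h₁, k₁⟩, ⟨h₂, k₂⟩, Set.union_subset h₃ k₃, by simp [Formula.freeRel, h₄, k₄],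
    fun M _ e n r => and_congr (h₅ M e n r) (k₅ M e n r)⟩

theorem or (hR : LFPDefinable L R) (hS : LFPDefinable L S) :
    LFPDefinable L fun M _ a b => R M a b ∨ S M a b :=
  (hR.not.and hS.not).not.congr fun M _ a b => by tauto

theorem all {ι : Type*} [Finite ι] {T : ι → ∀ (M : Type u) [L.Structure M], M → M → Prop}
    (hT : ∀ i, LFPDefinable L (T i)) : LFPDefinable L fun M _ a b => ∀ i, T i M a b := by
  classical
  have := Fintype.ofFinite ι
  have key : ∀ s : Finset ι, LFPDefinable L fun M _ a b => ∀ i ∈ s, T i M a b := by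
    intro s
    induction s using Finset.induction_on with
    | empty => exact true.congr fun M _ a b => by simp
    | insert i s _ ih => exact ((hT i).and ih).congr fun M _ a b => by simp
  exact (key Finset.univ).congr fun M _ a b => by simp

theorem any {ι : Type*} [Finite ι] {T : ι → ∀ (M : Type u) [L.Structure M], M → M → Prop}
    (hT : ∀ i, LFPDefinable L (T i)) : LFPDefinable L fun M _ a b => ∃ i, T i M a b :=
  (all fun i => (hT i).not).not.congr fun M _ a b => by simp

/-- Here `p` does not depend on the structure (it will be `π i = j`), so the query is either `R` or
the empty one. -/
theorem const_and (p : Prop) (hR : LFPDefinable L R) : LFPDefinable L fun M _ a b => p ∧ R M a b := by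
  by_cases hp : p
  · exact hR.congr fun M _ a b => by simp [hp]
  · exact true.not.congr fun M _ a b => by simp [hp]

theorem comp (hR : LFPDefinable L R) (hS : LFPDefinable L S) :
    LFPDefinable L fun M _ a b => ∃ c, R M a c ∧ S M c b := by
  obtain ⟨φ, h₁, h₂, h₃, h₄, h₅⟩ := hR
  obtain ⟨ψ, k₁, k₂, k₃, k₄, k₅⟩ := hS
  -- Substitution is emulated by requantifying: the midpoint is stored in variable 2, then 1 or 0 is
  -- rebound to equal it.
  refine ⟨.exElem 2 (.and (.exElem 1 (.and (.eq 1 2) φ)) (.exElem 0 (.and (.eq 0 2) ψ))),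
    ⟨⟨trivial, h₁⟩, trivial, k₁⟩, ⟨⟨trivial, h₂⟩, trivial, k₂⟩, ?_,
    by simp [Formula.freeRel, h₄, k₄], fun M _ e n r => ?_⟩
  · intro x hx
    simp only [Formula.freeElem, Set.mem_sdiff, Set.mem_union, Set.mem_insert_iff,
      Set.mem_singleton_iff] at hx
    have h := @h₃ x
    have k := @k₃ x
    simp only [Set.mem_insert_iff, Set.mem_singleton_iff] at h k ⊢
    tauto
  · simp [Formula.Realize, h₅, k₅]

/-- The relation variable used for reflexive transitive closures. -/
def rtcVar : RelVar := ⟨0, 2, 0⟩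

theorem reflTransGen (hR : LFPDefinable L R) :
    LFPDefinable L fun M _ a b => Relation.ReflTransGen (R M) a b := by
  obtain ⟨φ, h₁, h₂, h₃, h₄, h₅⟩ := hR
  -- This is `0 = 1 ∨ ∃ 2, X(0, 2) ∧ φ(2, 1)`. The double negation that encodes the disjunction
  -- keeps `X` positive.
  let step : Formula L := .neg (.and (.neg (.eq 0 1)) (.neg (.exElem 2
    (.and (.app rtcVar ![0, 2] Fin.elim0) (.exElem 0 (.and (.eq 0 2) φ))))))
  have hinj : Function.Injective (![0, 1] : Fin 2 → ℕ) := by decide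
  have hstep : ∀ (M : Type u) [L.Structure M] (e : ℕ → M) (n : ℕ → Num M)
      (r : ∀ X : RelVar, RelVal M X), step.Realize M e n r ↔
        e 0 = e 1 ∨ ∃ c, ((![e 0, c], Fin.elim0) :
          (Fin 2 → M) × (Fin 0 → Num M)) ∈ r rtcVar ∧ R M c (e 1) := by
    intro M _ e n r
    have h2 : ∀ c : M, (fun i => Function.update e 2 c (![0, 2] i)) = ![e 0, c] := by
      intro c; ext i; fin_cases i <;> simp
    have h0 : ∀ f : Fin 0 → Num M, f = Fin.elim0 := fun f => Subsingleton.elim _ _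
    simp only [step, Formula.Realize, h₅]
    simp only [rtcVar, h2, h0 (fun i => _)]
    simp
    tauto
  refine ⟨.lfp rtcVar ![0, 1] Fin.elim0 step ![0, 1] Fin.elim0,
    ⟨hinj, fun i => i.elim0, ⟨trivial, fun _ => rfl, trivial, ?_⟩, trivial, trivial, trivial, h₁⟩,
    ⟨rfl, trivial, rfl, trivial, h₂⟩, ?_, ?_, fun M _ e n r => ?_⟩
  · exact φ.occursOnly_of_notMem_freeRel _ (by simp [h₄]) _
  · intro x hx
    have h := @h₃ x
    have hrange : Set.range (![0, 1] : Fin 2 → ℕ) = {0, 1} := by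
      simp [Set.pair_comm]
    simp only [Formula.freeElem, step, Set.mem_sdiff, Set.mem_union, Set.mem_insert_iff,
      Set.mem_singleton_iff, rtcVar, hrange] at hx
    simp only [Matrix.range_cons, Matrix.range_empty, Set.mem_union, Set.mem_insert_iff,
      Set.mem_singleton_iff, Set.mem_empty_iff_false] at hx h ⊢
    tauto
  · simp [Formula.freeRel, step, h₄]
  · have hext : ∀ (p : Fin 2 → M) (i : Fin 2),
        Function.extend ![0, 1] p e (![0, 1] i) = p i := fun p i => hinj.extend_apply p e i
    have hext0 : ∀ p : Fin 2 → M, Function.extend ![0, 1] p e 0 = p 0 := fun p => hext p 0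
    have hext1 : ∀ p : Fin 2 → M, Function.extend ![0, 1] p e 1 = p 1 := fun p => hext p 1
    have hpt : (fun i => e (![0, 1] i)) = ![e 0, e 1] := by
      ext i; fin_cases i <;> rfl
    show (∀ S : Set ((Fin 2 → M) × (Fin 0 → Num M)), (∀ p : (Fin 2 → M) × (Fin 0 → Num M),
      step.Realize M (Function.extend ![0, 1] p.1 e) (Function.extend Fin.elim0 p.2 n)
        (Function.update r rtcVar S) → p ∈ S) → ((fun i => e (![0, 1] i), _) :
          (Fin 2 → M) × (Fin 0 → Num M)) ∈ S) ↔ _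
    simp only [hstep, hext0, hext1, hpt]
    constructor
    · intro h
      -- The closure itself is one of the relations that the least fixed point intersects.
      refine h {p | Relation.ReflTransGen (R M) (p.1 0) (p.1 1)} ?_
      rintro p (hp | ⟨c, hc, hcR⟩)
      · show Relation.ReflTransGen (R M) (p.1 0) (p.1 1)
        rw [hp]
      · exact Relation.ReflTransGen.tail hc hcR
    · intro h S hS
      have key : ∀ b, Relation.ReflTransGen (R M) (e 0) b →
          ∀ z : Fin 0 → Num M, (![e 0, b], z) ∈ S := by
        intro b hb
        induction hb with
        | refl => exact fun z => hS (_, z) (Or.inl rfl)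
        | tail _ hbc ih => exact fun z => hS (_, z) (Or.inr ⟨_, ih _, hbc⟩)
      exact key _ h _

theorem exists_sentence (hR : LFPDefinable L R) :
    ∃ φ : Sentence L, φ.formula.IsLFP ∧
      ∀ (M : Type u) [Nonempty M] [L.Structure M], φ.Holds M ↔ ∀ a : M, R M a a := by
  obtain ⟨φ, h₁, h₂, h₃, h₄, h₅⟩ := hR
  let ψ : Formula L := .neg (.exElem 0 (.exElem 1 (.and (.eq 0 1) (.neg φ))))
  have hlfp : ψ.IsLFP :=
    ⟨trivial, h₂⟩
  refine ⟨⟨ψ, ⟨trivial, h₁⟩, ?_, hlfp.freeNum_eq_empty, ?_⟩, hlfp, fun M _ _ => ?_⟩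
  · ext x
    have h := @h₃ x
    simp only [ψ, Formula.freeElem, Set.mem_sdiff, Set.mem_union, Set.mem_insert_iff,
      Set.mem_singleton_iff, Set.mem_empty_iff_false] at h ⊢
    tauto
  · simp [ψ, Formula.freeRel, h₄]
  · have hre : ∀ (e : ℕ → M) (n : ℕ → Num M) (r : ∀ X : RelVar, RelVal M X),
        ψ.Realize M e n r ↔ ∀ a : M, R M a a := by
      intro e n r
      simp [ψ, Formula.Realize, h₅]
    exact ⟨fun h => (hre (fun _ => Classical.arbitrary M) (fun _ => 0) (fun _ => ∅)).1 (h _ _ _),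
      fun h e n r => (hre e n r).2 h⟩

end LFPDefinable

/-! ### Reachability in a graph whose vertices carry finitely many labels -/

section Kleene

variable {M : Type*} {ι : Type*}

/-- One step of Kleene's algorithm: allow passing through vertices labelled `k`. -/
def through (k : ι) (E : ι → ι → M → M → Prop) (i j : ι) (a b : M) : Prop :=
  E i j a b ∨ ∃ d, (∃ c, E i k a c ∧ Relation.ReflTransGen (E k k) c d) ∧ E k j d b

/-- Kleene's algorithm: paths all of whose interior vertices have labels in the given list. -/
def throughList (E : ι → ι → M → M → Prop) : List ι → ι → ι → M → M → Prop
  | [] => E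
  | k :: l => through k (throughList E l)

theorem throughList_of_edge (E : ι → ι → M → M → Prop) (l : List ι) {i j : ι} {a b : M}
    (h : E i j a b) : throughList E l i j a b := by
  induction l with
  | nil => exact h
  | cons k l ih => exact Or.inl ih

/-- Two walks may be joined at a vertex whose label is allowed in the interior. If that label is the
one added last, the loops at it on both sides of the junction merge into one closure; otherwise the
junction is absorbed by the shorter list. -/
theorem throughList_trans (E : ι → ι → M → M → Prop) (l : List ι) {k : ι} (hk : k ∈ l)
    {i j : ι} {a b c : M} (h₁ : throughList E l i k a b) (h₂ : throughList E l k j b c) :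
    throughList E l i j a c := by
  induction l generalizing i j k a b c with
  | nil => simp at hk
  | cons m l ih =>
      by_cases hm : k = m
      · subst hm
        have h₁' : ∃ d, throughList E l i k a d ∧
            Relation.ReflTransGen (throughList E l k k) d b := by
          rcases h₁ with h | ⟨d, ⟨c', h, h'⟩, h''⟩
          · exact ⟨b, h, .refl⟩
          · exact ⟨c', h, h'.tail h''⟩
        have h₂' : ∃ d, Relation.ReflTransGen (throughList E l k k) b d ∧
            throughList E l k j d c := by
          rcases h₂ with h | ⟨d, ⟨c', h, h'⟩, h''⟩
          · exact ⟨b, .refl, h⟩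
          · exact ⟨d, .head h h', h''⟩
        obtain ⟨d, hd, hd'⟩ := h₁'
        obtain ⟨d', he, he'⟩ := h₂'
        exact Or.inr ⟨d', ⟨d, hd, hd'.trans he⟩, he'⟩
      · have hk' : k ∈ l := by
          rcases List.mem_cons.1 hk with h | h
          · exact absurd h hm
          · exact h
        rcases h₁ with h | ⟨d, ⟨c', h, h'⟩, h''⟩ <;> rcases h₂ with g | ⟨e, ⟨f, g, g'⟩, g''⟩
        · exact Or.inl (ih hk' h g)
        · exact Or.inr ⟨e, ⟨f, ih hk' h g, g'⟩, g''⟩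
        · exact Or.inr ⟨d, ⟨c', h, h'⟩, ih hk' h'' g⟩
        · exact Or.inr ⟨e, ⟨c', h, (h'.tail (ih hk' h'' g)).trans g'⟩, g''⟩

/-- The edge relation on labelled vertices. -/
def labelledEdge (E : ι → ι → M → M → Prop) (v w : M × ι) : Prop :=
  E v.2 w.2 v.1 w.1

theorem transGen_of_throughList (E : ι → ι → M → M → Prop) (l : List ι) {i j : ι} {a b : M}
    (h : throughList E l i j a b) : Relation.TransGen (labelledEdge E) (a, i) (b, j) := by
  induction l generalizing i j a b with
  | nil => exact .single h
  | cons k l ih =>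
      rcases h with h | ⟨d, ⟨c, h, h'⟩, h''⟩
      · exact ih h
      · have : Relation.ReflTransGen (labelledEdge E) (c, k) (d, k) :=
          h'.lift' (fun x => (x, k)) fun _ _ hxy => (ih hxy).to_reflTransGen
        exact ((ih h).trans_left this).trans (ih h'')

theorem throughList_iff_transGen (E : ι → ι → M → M → Prop) (l : List ι) (hl : ∀ i, i ∈ l)
    {i j : ι} {a b : M} :
    throughList E l i j a b ↔ Relation.TransGen (labelledEdge E) (a, i) (b, j) := by
  refine ⟨transGen_of_throughList E l, fun h => ?_⟩
  have key : ∀ w : M × ι, Relation.TransGen (labelledEdge E) (a, i) w →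
      throughList E l i w.2 a w.1 := by
    intro w hw
    induction hw with
    | single h => exact throughList_of_edge E l h
    | tail _ h ih => exact throughList_trans E l (hl _) ih (throughList_of_edge E l h)
  exact key _ h

end Kleene

/-- Eliminating labels one at a time needs only fixed points of a single binary relation, instead of
a simultaneous one over all pairs of labels. -/
theorem LFPDefinable.throughList {ι : Type}
    {E : ∀ (M : Type u) [L.Structure M], ι → ι → M → M → Prop}
    (hE : ∀ i j, LFPDefinable L fun M _ => E M i j) (l : List ι) (i j : ι) :
    LFPDefinable L fun M _ => throughList (E M) l i j := by
  induction l generalizing i j with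
  | nil => exact hE i j
  | cons k l ih => exact (ih i j).or (((ih i k).comp (ih k k).reflTransGen).comp (ih k j))

end FPC

/-! ### Complete satisfiability as consistency of forced labels. -/

namespace UG

variable {q : ℕ}

section Semantics

variable {M : Type u} [(vocabulary q).Structure M]

/-- `P π` holds of `(a, b)`. -/
def Constraint (π : Equiv.Perm (Fin q)) (a b : M) : Prop :=
  FirstOrder.Language.Structure.RelMap (L := vocabulary q) (Rel.P π) ![a, b]

variable (M) in
/-- Some constraint between `a` and `b` propagates label `i` of `a` to label `j` of `b`. -/
def Propagates (i j : Fin q) (a b : M) : Prop :=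
  ∃ π : Equiv.Perm (Fin q), (π i = j ∧ Constraint π a b) ∨ (π j = i ∧ Constraint π b a)

/-- Labels of variables that are forced by other ones. -/
abbrev Forces : M × Fin q → M × Fin q → Prop :=
  Relation.ReflTransGen (FPC.labelledEdge (Propagates M))

theorem Forces.symm {v w : M × Fin q} (h : Forces v w) : Forces w v := by
  have : Std.Symm (FPC.labelledEdge (Propagates (q := q) M)) := by
    refine ⟨?_⟩
    rintro v w ⟨π, h | h⟩
    · exact ⟨π, Or.inr h⟩
    · exact ⟨π, Or.inl h⟩
  exact Relation.ReflTransGen.stdSymm.symm _ _ h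

theorem Forces.exists_parallel {v w : M × Fin q} (h : Forces v w) (i : Fin q) :
    ∃ j, Forces (v.1, i) (w.1, j) ∧ (v.2 ≠ i → w.2 ≠ j) := by
  induction h with
  | refl => exact ⟨i, .refl, id⟩
  | tail _ hst ih =>
      obtain ⟨j, hj, hne⟩ := ih
      obtain ⟨π, ⟨h, hc⟩ | ⟨h, hc⟩⟩ := hst
      · refine ⟨π j, hj.tail ⟨π, Or.inl ⟨rfl, hc⟩⟩, fun hi heq => hne hi ?_⟩
        exact π.injective (h.trans heq)
      · refine ⟨π.symm j, hj.tail ⟨π, Or.inr ⟨by simp, hc⟩⟩, fun hi heq => hne hi ?_⟩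
        rw [← h, heq, Equiv.apply_symm_apply]

/-- If `j ≠ k`, following the walk to `(b, k)` backwards from `(b, j)` ends at a label of `a` other
than `i`, which `(a, i)` then forces. -/
theorem Forces.eq_of_consistent {a b : M} {i j k : Fin q}
    (hi : ∀ i', Forces (a, i) (a, i') → i' = i)
    (hj : Forces (a, i) (b, j)) (hk : Forces (a, i) (b, k)) : j = k := by
  by_contra hne
  obtain ⟨i', h, h'⟩ := hk.symm.exists_parallel j
  exact h' (fun h => hne h.symm) (hi i' (hj.trans h)).symm

theorem Forces.eq_apply {f : M → Fin q} (hf : ∀ c ∈ constraints q M, Satisfies f c)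
    {v w : M × Fin q} (h : Forces v w) (hv : v.2 = f v.1) : w.2 = f w.1 := by
  induction h with
  | refl => exact hv
  | @tail s t _ hst ih =>
      obtain ⟨π, ⟨h, hc⟩ | ⟨h, hc⟩⟩ := hst
      · have : π (f s.1) = f t.1 := hf (π, s.1, t.1) hc
        rw [← h, ih, this]
      · have : π (f t.1) = f s.1 := hf (π, t.1, s.1) hc
        exact π.injective (by rw [h, ih, this])

theorem completelySatisfiable_iff :
    CompletelySatisfiable q M ↔
      ∀ a : M, ∃ i : Fin q, ∀ i', Forces (a, i) (a, i') → i' = i := by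
  constructor
  · rintro ⟨f, hf⟩ a
    exact ⟨f a, fun i' h => h.eq_apply hf rfl⟩
  · intro h
    choose g hg using h
    -- The classes are the connected components. Two walks may meet with different labels, so
    -- transitivity uses a parallel walk.
    let s : Setoid M :=
      { r := fun a b => ∃ i j : Fin q, Forces (a, i) (b, j)
        iseqv :=
          { refl := fun a => ⟨g a, g a, .refl⟩
            symm := fun ⟨i, j, h⟩ => ⟨j, i, h.symm⟩
            trans := fun ⟨i, j, h⟩ ⟨k, _, h'⟩ => by
              obtain ⟨m, hm, -⟩ := h'.exists_parallel j
              exact ⟨i, m, h.trans hm⟩ } }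
    -- The labels `g a` need not fit together; only those at the roots are used.
    let root : M → M := fun a => (Quotient.mk s a).out
    have hroot : ∀ a, ∃ j, Forces (root a, g (root a)) (a, j) := by
      intro a
      obtain ⟨i, j, hij⟩ : s.r (root a) a := Quotient.mk_out (s := s) a
      obtain ⟨m, hm, -⟩ := hij.exists_parallel (g (root a))
      exact ⟨m, hm⟩
    choose f hf using hroot
    refine ⟨f, ?_⟩
    rintro ⟨π, a, b⟩ hc
    -- The root's label forces both `π (f a)` and `f b` at `b`, so they coincide.
    have hab : Forces (a, f a) (b, π (f a)) := .single ⟨π, Or.inl ⟨rfl, hc⟩⟩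
    have hr : root b = root a :=
      congrArg Quotient.out (Quotient.sound (s := s) ⟨_, _, hab.symm⟩)
    have hb := hf b
    rw [hr] at hb
    exact Forces.eq_of_consistent (hg (root a)) ((hf a).trans hab) hb

end Semantics

theorem lfpDefinable_propagates (i j : Fin q) :
    FPC.LFPDefinable (vocabulary q) fun (M : Type u) _ => Propagates M i j :=
  .any fun π => (FPC.LFPDefinable.const_and _ (.rel (L := vocabulary q) (Rel.P π))).or
    (FPC.LFPDefinable.const_and _ (.relSwap (L := vocabulary q) (Rel.P π)))

variable (q) in
theorem exists_lfp_sentence :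
    ∃ φ : FPC.Sentence (vocabulary q), φ.formula.IsLFP ∧
      ∀ (M : Type u) [Nonempty M] [(vocabulary q).Structure M],
        φ.Holds M ↔ CompletelySatisfiable q M := by
  have hdef : FPC.LFPDefinable (vocabulary q) fun (M : Type u) _ (a b : M) =>
      ∃ i : Fin q, ∀ i' : Fin q,
        ¬ (i' ≠ i ∧ FPC.throughList (Propagates M) (List.finRange q) i i' a b) :=
    .any fun i => .all fun i' =>
      (FPC.LFPDefinable.const_and _ (.throughList lfpDefinable_propagates _ i i')).not
  obtain ⟨φ, hφ, h⟩ := hdef.exists_sentence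
  refine ⟨φ, hφ, fun M _ _ => (h M).trans ?_⟩
  rw [completelySatisfiable_iff]
  refine forall_congr' fun a => exists_congr fun i => forall_congr' fun i' => ?_
  -- `throughList` misses the empty walk, which is harmless because `i' ≠ i` excludes it.
  rw [FPC.throughList_iff_transGen _ _ List.mem_finRange, Forces,
    Relation.reflTransGen_iff_eq_or_transGen, Prod.mk.injEq]
  tauto

end UG

/-! ### Bounded-variable formulas for walks. -/

namespace Ck.Formula

variable {L : FirstOrder.Language.{0, 0}} {k : ℕ}

/-- Infinitary disjunction. -/
def disj {ι : Type} (φ : ι → Formula L k) : Formula L k :=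
  .neg (.conj fun i => .neg (φ i))

/-- The quantifier `∃ x`. -/
def ex (x : Fin k) (φ : Formula L k) : Formula L k :=
  .exGe 1 x φ

theorem free_disj {ι : Type} (φ : ι → Formula L k) : (disj φ).free = ⋃ i, (φ i).free := rfl

theorem free_ex (x : Fin k) (φ : Formula L k) : (ex x φ).free = φ.free \ {x} := rfl

theorem free_and_bool (φ : Bool → Formula L k) :
    (Formula.conj φ).free = (φ true).free ∪ (φ false).free := by
  ext x
  simp [Formula.free, or_comm]

variable {M : Type u} [L.Structure M]

theorem realize_disj {ι : Type} (φ : ι → Formula L k) (e : Fin k → M) :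
    (disj φ).Realize M e ↔ ∃ i, (φ i).Realize M e := by
  simp [disj, Formula.Realize]

theorem realize_ex [Finite M] (x : Fin k) (φ : Formula L k) (e : Fin k → M) :
    (ex x φ).Realize M e ↔ ∃ a, φ.Realize M (Function.update e x a) := by
  show 1 ≤ Set.ncard _ ↔ _
  exact Set.ncard_pos (Set.toFinite _)

end Ck.Formula

namespace UG

variable {q : ℕ}

open Ck.Formula

/-- The relation `Propagates`, as a formula. -/
def propagatesFormula (i j : Fin q) (a b : Fin 3) : Ck.Formula (vocabulary q) 3 :=
  .disj fun π : {π : Equiv.Perm (Fin q) × Bool // if π.2 then π.1 i = j else π.1 j = i} =>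
    .rel (L := vocabulary q) (n := 2) (Rel.P π.1.1) (if π.1.2 then ![a, b] else ![b, a])

/-- `walkFormula n i j a b` says that `n` steps of propagation lead from label `i` of `a` to label
`j` of `b`, with `c` as an auxiliary variable. -/
def walkFormula : ℕ → Fin q → Fin q → Fin 3 → Fin 3 → Fin 3 → Ck.Formula (vocabulary q) 3
  -- The index type is empty when `i ≠ j`, which makes the disjunction false.
  | 0, i, j, a, b, _ => .disj fun _ : PLift (i = j) => .eq a b
  | n + 1, i, j, a, b, c => .ex c (.disj fun m : Fin q => .conj fun t : Bool =>
      -- After the step to `c` the variable `a` is no longer needed and becomes the auxiliary one,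
      -- so three variables suffice.
      if t then propagatesFormula i m a c else walkFormula n m j c b a)

theorem free_propagatesFormula (i j : Fin q) (a b : Fin 3) :
    (propagatesFormula i j a b).free ⊆ {a, b} := by
  rw [propagatesFormula, free_disj]
  refine Set.iUnion_subset fun π => ?_
  split_ifs <;> simp [Ck.Formula.free, Set.pair_comm]

theorem free_walkFormula (n : ℕ) (i j : Fin q) (a b c : Fin 3) :
    (walkFormula n i j a b c).free ⊆ {a, b} := by
  induction n generalizing i j a b c with
  | zero =>
      rw [walkFormula, free_disj]
      exact Set.iUnion_subset fun _ => subset_rfl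
  | succ n ih =>
      rw [walkFormula, free_ex, free_disj]
      rintro x ⟨hx, hxc⟩
      obtain ⟨m, hm⟩ := Set.mem_iUnion.1 hx
      rw [free_and_bool] at hm
      rcases hm with hm | hm
      · have := free_propagatesFormula i m a c hm
        simp only [Set.mem_insert_iff, Set.mem_singleton_iff] at this hxc ⊢
        tauto
      · have := ih m j c b a hm
        simp only [Set.mem_insert_iff, Set.mem_singleton_iff] at this hxc ⊢
        tauto

variable {M : Type u} [(vocabulary q).Structure M]

theorem realize_propagatesFormula (i j : Fin q) (a b : Fin 3) (e : Fin 3 → M) :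
    (propagatesFormula i j a b).Realize M e ↔ Propagates M i j (e a) (e b) := by
  have h : ∀ x y : Fin 3, (fun t => e ((![x, y] : Fin 2 → Fin 3) t)) = ![e x, e y] := by
    intro x y; ext t; fin_cases t <;> rfl
  rw [propagatesFormula, realize_disj]
  constructor
  · rintro ⟨⟨⟨π, t⟩, hπ⟩, hr⟩
    cases t
    · refine ⟨π, Or.inr ⟨by simpa using hπ, ?_⟩⟩
      rw [Constraint, ← h]
      exact hr
    · refine ⟨π, Or.inl ⟨by simpa using hπ, ?_⟩⟩
      rw [Constraint, ← h]
      exact hr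
  · rintro ⟨π, ⟨hπ, hr⟩ | ⟨hπ, hr⟩⟩ <;> rw [Constraint, ← h] at hr
    · exact ⟨⟨(π, true), by simpa using hπ⟩, hr⟩
    · exact ⟨⟨(π, false), by simpa using hπ⟩, hr⟩

/-- `w` can be reached from `v` in exactly `n` steps. -/
def StepsTo {α : Type*} (E : α → α → Prop) : ℕ → α → α → Prop
  | 0, v, w => v = w
  | n + 1, v, w => ∃ u, E v u ∧ StepsTo E n u w

theorem reflTransGen_iff_exists_stepsTo {α : Type*} (E : α → α → Prop) (v w : α) :
    Relation.ReflTransGen E v w ↔ ∃ n, StepsTo E n v w := by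
  constructor
  · intro h
    induction h using Relation.ReflTransGen.head_induction_on with
    | refl => exact ⟨0, rfl⟩
    | head h _ ih =>
        obtain ⟨n, hn⟩ := ih
        exact ⟨n + 1, _, h, hn⟩
  · rintro ⟨n, h⟩
    induction n generalizing v with
    | zero => exact h ▸ .refl
    | succ n ih =>
        obtain ⟨u, hu, hn⟩ := h
        exact .head hu (ih u hn)

theorem realize_walkFormula [Finite M] (n : ℕ) (i j : Fin q) (a b c : Fin 3)
    (hab : a ≠ b) (hac : a ≠ c) (hbc : b ≠ c) (e : Fin 3 → M) :
    (walkFormula n i j a b c).Realize M e ↔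
      StepsTo (FPC.labelledEdge (Propagates M)) n (e a, i) (e b, j) := by
  induction n generalizing i j a b c e with
  | zero =>
      rw [walkFormula, realize_disj, StepsTo, Prod.mk.injEq]
      exact ⟨fun ⟨⟨h⟩, h'⟩ => ⟨h', h⟩, fun ⟨h, h'⟩ => ⟨⟨h'⟩, h⟩⟩
  | succ n ih =>
      simp only [walkFormula, realize_ex, realize_disj, StepsTo, Prod.exists]
      refine exists_congr fun x => exists_congr fun m => ?_
      simp only [Ck.Formula.Realize, Bool.forall_bool, if_true, Bool.false_eq_true, if_false,
        realize_propagatesFormula, ih m j c b a hbc.symm hac.symm hab.symm,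
        Function.update_self, Function.update_of_ne hac, Function.update_of_ne hbc]
      exact and_comm

/-- Some label of the variable `0` does not force another label of the same variable. -/
def consistentFormula (q : ℕ) : Ck.Formula (vocabulary q) 3 :=
  .disj fun i : Fin q => .conj fun t : {i' : Fin q // i' ≠ i} × ℕ =>
    -- The realization lemma for walks needs distinct endpoint variables, so a closed walk ends at a
    -- variable 1 required to equal 0.
    .neg (.ex 1 (.conj fun s : Bool => if s then .eq 0 1 else walkFormula t.2 i t.1 0 1 2))

theorem free_consistentFormula (q : ℕ) : (consistentFormula q).free ⊆ {0} := by
  rw [consistentFormula, free_disj]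
  refine Set.iUnion_subset fun i => Set.iUnion_subset fun t => ?_
  rw [Ck.Formula.free, free_ex, free_and_bool]
  rintro x ⟨hx, hx1⟩
  have h := @free_walkFormula q t.2 i t.1 0 1 2 x
  simp only [if_true, Bool.false_eq_true, if_false, Ck.Formula.free, Set.mem_union,
    Set.mem_insert_iff, Set.mem_singleton_iff] at hx hx1 h ⊢
  tauto

theorem realize_consistentFormula [Finite M] (e : Fin 3 → M) :
    (consistentFormula q).Realize M e ↔
      ∃ i : Fin q, ∀ i', Forces (e 0, i) (e 0, i') → i' = i := by
  rw [consistentFormula, realize_disj]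
  refine exists_congr fun i => ?_
  have h01 : (0 : Fin 3) ≠ 1 := by decide
  simp only [Ck.Formula.Realize, realize_ex, Bool.forall_bool, if_true, Bool.false_eq_true,
    if_false, realize_walkFormula _ _ _ (0 : Fin 3) 1 2 (by decide) (by decide) (by decide),
    Function.update_self, Function.update_of_ne h01, Forces, reflTransGen_iff_exists_stepsTo]
  constructor
  · rintro h i' ⟨n, hn⟩
    by_contra hne
    exact h (⟨i', hne⟩, n) ⟨e 0, hn, rfl⟩
  · rintro h ⟨⟨i', hne⟩, n⟩ ⟨a, hn, ha⟩
    exact hne (h i' ⟨n, by rw [ha]; rwa [ha] at hn⟩)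

theorem exists_ck_sentence (q : ℕ) :
    ∃ ψ : Ck.Sentence (vocabulary q) 3,
      ∀ (M : Type u) [Finite M] [Nonempty M] [(vocabulary q).Structure M],
        ψ.Holds M ↔ CompletelySatisfiable q M := by
  refine ⟨⟨.neg (.ex 0 (.neg (consistentFormula q))), ?_⟩, fun M _ _ _ => ?_⟩
  · rw [Ck.Formula.free, free_ex, Ck.Formula.free, Set.sdiff_eq_empty]
    exact free_consistentFormula q
  · rw [completelySatisfiable_iff]
    have hre : ∀ e : Fin 3 → M,
        (Ck.Formula.neg (.ex 0 (.neg (consistentFormula q)))).Realize M e ↔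
          ∀ a : M, ∃ i : Fin q, ∀ i', Forces (a, i) (a, i') → i' = i := by
      intro e
      simp only [Ck.Formula.Realize, realize_ex, realize_consistentFormula, Function.update_self]
      push Not
      rfl
    exact ⟨fun h => (hre fun _ => Classical.arbitrary M).1 (h _), fun h e => (hre e).2 h⟩

/-! ### Optimal value 1 and complete satisfiability. -/

theorem satFraction_eq_one_iff (q : ℕ) (M : Type u) [Finite M] [(vocabulary q).Structure M]
    (f : M → Fin q) : satFraction q M f = 1 ↔ ∀ c ∈ constraints q M, Satisfies f c := by
  rw [satFraction]
  split_ifs with h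
  · simp [h]
  · have hne : (Set.ncard (constraints q M) : ℝ) ≠ 0 := by
      simpa [Set.ncard_eq_zero (Set.toFinite _)] using h
    rw [div_eq_one_iff_eq hne, Nat.cast_inj]
    constructor
    · intro hc c hmem
      have := Set.eq_of_subset_of_ncard_le
        (Set.sep_subset (constraints q M) (Satisfies f)) hc.ge (Set.toFinite _)
      rw [← this] at hmem
      exact hmem.2
    · intro hc
      rw [Set.sep_eq_self_iff_mem_true.2 hc]

theorem satFraction_le_one (q : ℕ) (M : Type u) [Finite M] [(vocabulary q).Structure M]
    (f : M → Fin q) : satFraction q M f ≤ 1 := by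
  rw [satFraction]
  split_ifs with h
  · exact le_rfl
  · exact div_le_one_of_le₀
      (Nat.cast_le.2 (Set.ncard_le_ncard (Set.sep_subset _ _) (Set.toFinite _)))
      (Nat.cast_nonneg _)

theorem one_le_opt_iff (q : ℕ) (hq : 0 < q) (M : Type u) [Finite M]
    [(vocabulary q).Structure M] : 1 ≤ opt q M ↔ CompletelySatisfiable q M := by
  have : Nonempty (Fin q) := ⟨⟨0, hq⟩⟩
  constructor
  · intro h
    -- There are finitely many assignments, and at least one as `q > 0`, so some `f` attains the
    -- supremum.
    obtain ⟨f, hf⟩ := exists_eq_ciSup_of_finite (f := satFraction q M)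
    exact ⟨f, (satFraction_eq_one_iff q M f).1
      (le_antisymm (satFraction_le_one q M f) (hf ▸ h))⟩
  · rintro ⟨f, hf⟩
    rw [← (satFraction_eq_one_iff q M f).2 hf]
    exact le_ciSup (Set.finite_range _).bddAbove f

end UG

theorem mainTheorem7 (q : ℕ) (hq : 0 < q) :
    (∃ φ : FPC.Sentence (UG.vocabulary q),
      φ.formula.IsLFP ∧
      (∀ (M : Type u) [Finite M] [Nonempty M] [(UG.vocabulary q).Structure M],
        φ.Holds M ↔ UG.CompletelySatisfiable q M) ∧
      ∃ ψ : Ck.Sentence (UG.vocabulary q) 3,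
        ∀ (M : Type u) [Finite M] [Nonempty M] [(UG.vocabulary q).Structure M],
          ψ.Holds M ↔ φ.Holds M) ∧
    (∀ δ : ℝ, δ ≤ 1 → ¬ UG.HasFPCInapproximabilityGap.{u} q 1 δ) := by
  obtain ⟨φ, hφ, h⟩ := UG.exists_lfp_sentence.{u} q
  obtain ⟨ψ, hψ⟩ := UG.exists_ck_sentence.{u} q
  refine ⟨⟨φ, hφ, fun M _ _ _ => h M, ψ, fun M _ _ _ => (hψ M).trans (h M).symm⟩, ?_⟩
  intro δ hδ hgap
  refine hgap ⟨φ, fun M _ _ _ => ⟨fun h1 => ?_, fun h1 h2 => ?_⟩⟩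
  · exact (h M).2 ((UG.one_le_opt_iff q hq M).1 h1)
  · exact absurd (h1.trans_le hδ) (not_lt.2 ((UG.one_le_opt_iff q hq M).2 ((h M).1 h2)))
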